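/- Consider the CONGEST model: the network is a connected undirected unweighted graph $G$ on $n$ nodes with unique ids in $\{1,\dots,n\}$; initially each node knows only $n$, its own id, the ids of its neighbours, and its own private random tape of independent fair bits, independent of the tapes of the other nodes. In each synchronous round each node sends to each of its neighbours a (possibly different) message of $O(\log n)$ bits, receives the messages of its neighbours, and updates its state by an arbitrary local computation. At the end each node declares whether it is a center. For nodes $u,v$ let $\mathrm{d}(u,v)$ be the number of edges of a shortest path between them, and let $\mathrm{OPT}_1(G)=\min_{s\in V}\max_{v\in V}\mathrm{d}(v,s)$. An $\alpha$-approximation for $1$-center is a node $s$ with $\mathrm{d}(v,s)\le\alpha\cdot\mathrm{OPT}_1(G)$ for all $v\in V$. Theorem. For every $1\le\alpha<4/3$, any CONGEST algorithm, even a randomized one that need only be correct with probability at least $2/3$ on each network, that returns an $\alpha$-approximation for $1$-center needs $\Omega(n/\log^2 n)$ rounds. Precisely: for every $\beta>0$ there are $c>0$ and $n_0$ such that for all $n\ge n_0$ and all $1\le\alpha<4/3$, if an algorithm for $n$-node networks, with messages of at most $\beta\log n$ bits, after $T$ rounds outputs with probability at least $2/3$ exactly one center, which is an $\alpha$-approximation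 for $1$-center, on every connected $n$-node graph, then $T\ge c\,n/\log^2 n$. -/

import Mathlib

open MeasureTheory
open scoped ENNReal

namespace KCenter

/-- `max_{v} min_{s ∈ S} d(v, s)`, with `d` the unweighted shortest-path distance
(`⊤` if some node cannot reach `S`, in particular if `S` is empty and there is a node). -/
noncomputable def coverRadius {V : Type*} (G : SimpleGraph V) (S : Finset V) : ℕ∞ :=
  ⨆ v : V, ⨅ s ∈ S, G.edist v s

/-- `OPT_k(G)`: the least covering radius of a set of at most `k` nodes. -/
noncomputable def opt {V : Type*} (G : SimpleGraph V) (k : ℕ) : ℕ∞ :=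
  ⨅ S : {S : Finset V // S.card ≤ k}, coverRadius G S.1

/-- `S` is an `α`-approximate solution of the `k`-center problem on `G`: it has at most `k`
nodes, and every node is at distance at most `α * OPT_k(G)` from its nearest node in `S`. -/
def IsApprox {V : Type*} (G : SimpleGraph V) (k : ℕ) (α : ℝ) (S : Finset V) : Prop :=
  S.card ≤ k ∧
    ((coverRadius G S : ℕ∞) : ℝ≥0∞) ≤ ENNReal.ofReal α * ((opt G k : ℕ∞) : ℝ≥0∞)

end KCenter

namespace Congest

/-- A message of at most `b` bits (the empty string amounts to sending nothing). -/
abbrev Message (b : ℕ) : Type := {w : List Bool // w.length ≤ b}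

/-- The private random tape of a node: an infinite sequence of bits. -/
abbrev Tape : Type := ℕ → Bool

/-- The law of a tape: independent fair bits. -/
noncomputable def tapeLaw : Measure Tape :=
  Measure.infinitePi fun _ : ℕ => (PMF.uniformOfFintype Bool).toMeasure

/-- The joint law of the tapes of `n` nodes: the tapes are independent. -/
noncomputable def tapesLaw (n : ℕ) : Measure (Fin n → Tape) :=
  Measure.pi fun _ : Fin n => tapeLaw

/-- A randomized synchronous message-passing algorithm for networks of `n` nodes, whose ids are
the elements of `Fin n`, with messages of at most `b` bits.  Local computation is unrestricted.

* `start v N ρ` is the initial state of the node with id `v`, whose neighbours have the ids in `N`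
  and whose random tape is `ρ`;
* `send s u` is the message that a node in state `s` sends to its neighbour `u`;
* `step s inbox` is the new state of a node in state `s` after it received `inbox`, where
  `inbox u` is the message received from `u`, and `none` if `u` is not a neighbour;
* `output s` tells whether a node that ends in state `s` declares itself a member of the
  output set.

The remaining fields say that all of this is measurable, so that events about executions have
probabilities.  A deterministic algorithm is one that ignores its tapes. -/
structure Algorithm (n b : ℕ) where
  State : Type
  measurableSpaceState : MeasurableSpace State
  start : Fin n → Set (Fin n) → Tape → State
  send : State → Fin n → Message b
  step : State → (Fin n → Option (Message b)) → State
  output : State → Bool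
  measurable_start : ∀ v N, Measurable (start v N)
  measurable_send : ∀ u m, MeasurableSet {s | send s u = m}
  measurable_step : ∀ inbox, Measurable fun s => step s inbox
  measurable_output : MeasurableSet {s | output s = true}

namespace Algorithm

open Classical in
/-- The states of all nodes after `t` synchronous rounds on the network `G` with tapes `ρ`. -/
noncomputable def run {n b : ℕ} (A : Algorithm n b) (G : SimpleGraph (Fin n))
    (ρ : Fin n → Tape) : ℕ → Fin n → A.State
  | 0, v => A.start v (G.neighborSet v) (ρ v)
  | t + 1, v =>
      A.step (A.run G ρ t v) fun u =>
        if G.Adj u v then some (A.send (A.run G ρ t u) v) else none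

/-- The set of nodes that declare themselves members of the output after `t` rounds. -/
noncomputable def outputSet {n b : ℕ} (A : Algorithm n b) (G : SimpleGraph (Fin n))
    (ρ : Fin n → Tape) (t : ℕ) : Finset (Fin n) :=
  Finset.univ.filter fun v => A.output (A.run G ρ t v) = true

/-- On every connected `n`-node network, after `T` rounds the output of `A` is, with probability
at least `2/3`, an `α`-approximate solution of the `k`-center problem. -/
def ApproximatesKCenter {n b : ℕ} (A : Algorithm n b) (k : ℕ) (α : ℝ) (T : ℕ) : Prop :=
  ∀ G : SimpleGraph (Fin n), G.Connected →
    (2 / 3 : ℝ≥0∞) ≤ tapesLaw n {ρ | KCenter.IsApprox G k α (A.outputSet G ρ T)}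

end Algorithm

end Congest

/-!
The proof is a reduction from two-party set disjointness.

*Network.* For `x, y ⊆ Fin N` with `N = n / 4`, the network `Node.network` has a candidate and a
checker for each `i : Fin N`. A candidate is within distance `3` of all nodes if and only if
its index lies in both sets, and no other node is within distance `3` of all nodes
(`Node.edist_candidate_le`, `Node.exists_candidate_of_edist_le`). Hence, if `x` and `y` meet, the
optimum is at most `3`, every radius admitted by a factor below `4 / 3` is at most `3` as well, and
an approximate center names a common element of `x` and `y`. Only `O(log n)` edges join the part
of the network that depends on `x` to the part that depends on `y`, since candidates and checkers
are connected through nodes for the bits of their indices.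

*Simulation.* For fixed tapes, the messages crossing these edges form the transcript of a two-party
protocol (`Congest.Algorithm.run_eq_of_cut`), with `O(T * b * log n)` bits. After the execution the
parties exchange the chosen candidate and check it, so the protocol never errs on disjoint
sets. This one-sided error is what makes it possible to fix five tapes in succession so that the
protocol misses at most a fraction `3⁻⁵` of the hard inputs (`exists_sample_points`).

*Disjointness.* The hard inputs are Razborov's: every point is given to one of the parties, which
includes it in its set with probability `1 / 2`; for a pair of meeting sets one random point is
added to both. The corruption bound `disjointMass_le_meetingMass` says that a rectangle of inputs
that has not exponentially small weight under the disjoint pairs has comparable weight under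
the meeting pairs. It rests on `cardBelow_le_of_biased`, a substitute for the subadditivity of
entropy: a large family of subsets of `S` contains most points of `S` with a frequency bounded away
from `0` and `1`. Adding up over the transcripts gives `2 ^ Ω(N)` of them (`card_transcripts_ge`),
hence `T * b * log n = Ω(n)`.
-/

namespace CenterLowerBound

/-! ### The corruption bound for set disjointness -/

/-- The number of members of `C` contained in `S`. -/
noncomputable def cardBelow {ι : Type*} [DecidableEq ι] (C : Finset (Finset ι)) (S : Finset ι) :
    ℕ :=
  (C.filter (· ⊆ S)).card

/-- The number of members of `C` that are contained in `S` and contain `i`. -/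
noncomputable def cardBelowMem {ι : Type*} [DecidableEq ι] (C : Finset (Finset ι)) (S : Finset ι)
    (i : ι) : ℕ :=
  (C.filter fun x => x ⊆ S ∧ i ∈ x).card

/-- The points of `S` at which a member of `C` contained in `S`, drawn uniformly, is noticeably
biased: it contains the point, or avoids it, with probability less than `1 / 4`. -/
noncomputable def biased {ι : Type*} [DecidableEq ι] (C : Finset (Finset ι)) (S : Finset ι) :
    Finset ι :=
  S.filter fun i =>
    4 * cardBelowMem C S i < cardBelow C S ∨ 4 * cardBelow C (S.erase i) < cardBelow C S

section Corruption

variable {ι : Type*} [DecidableEq ι]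

lemma exp_quarter_mul_le : Real.exp (1 / 4) * (1 + Real.exp (-1)) ≤ 2 * (9 / 10) := by
  have h1 : Real.exp (1 / 4) ≤ 1.29 := by
    have : Real.exp (1 / 4) ^ 4 ≤ 1.29 ^ 4 := by
      rw [← Real.exp_nat_mul]
      have := Real.exp_one_lt_d9
      norm_num at this ⊢
      linarith
    exact le_of_pow_le_pow_left₀ (by norm_num) (by norm_num) this
  have h2 : Real.exp (-1) ≤ 0.37 := by
    rw [Real.exp_neg]
    have := Real.exp_one_gt_d9
    rw [inv_le_comm₀ (Real.exp_pos 1) (by norm_num)]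
    norm_num at this ⊢
    linarith
  nlinarith [Real.exp_pos (1 / 4), Real.exp_pos (-1)]

/-- A family with many biased points is small.  Charge each `x` the number `e x` of biased points at
which it takes the rare value; on average over the family this is at most `B / 4`, where `B` is the
number of biased points, so the size of the family is at most the sum of `exp (B / 4 - e x)` over
it, and the same sum over all subsets of `S` factorizes. -/
lemma cardBelow_le_of_biased (C : Finset (Finset ι)) (S : Finset ι) :
    (cardBelow C S : ℝ) ≤ 2 ^ S.card * (9 / 10) ^ (biased C S).card := by
  classical
  set F : ℝ := (cardBelow C S : ℝ) with hF
  let p : ι → Prop := fun i => 4 * cardBelowMem C S i < cardBelow C S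
  let q : ι → Prop := fun i => ¬ p i ∧ 4 * cardBelow C (S.erase i) < cardBelow C S
  let a : ι → ℝ := fun i => if p i then 1 else 0
  let b : ι → ℝ := fun i => if q i then 1 else 0
  let e : Finset ι → ℝ := fun x => ∑ i ∈ S, if i ∈ x then a i else b i
  have hcard : ((biased C S).card : ℝ) = ∑ i ∈ S, (a i + b i) := by
    rw [biased, Finset.card_filter]
    push_cast
    refine Finset.sum_congr rfl fun i _ => ?_
    by_cases h1 : p i
    · have : ¬ q i := fun h => h.1 h1
      simp only [a, b, h1, this]
      simp only [p] at h1
      simp [h1]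
    · by_cases h2 : q i
      · simp only [a, b, h1, h2]
        have := h2.2
        simp [this]
      · have h3 : ¬ (4 * cardBelowMem C S i < cardBelow C S ∨
            4 * cardBelow C (S.erase i) < cardBelow C S) := by
          rintro (h | h)
          · exact h1 h
          · exact h2 ⟨h1, h⟩
        simp [a, b, h1, h2, h3]
  set B : ℝ := ((biased C S).card : ℝ) with hB
  set C' := C.filter (· ⊆ S) with hC'
  have hsum : ∑ x ∈ C', e x ≤ B / 4 * F := by
    calc ∑ x ∈ C', e x = ∑ i ∈ S, ∑ x ∈ C', (if i ∈ x then a i else b i) := Finset.sum_comm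
      _ = ∑ i ∈ S, (cardBelowMem C S i * a i + cardBelow C (S.erase i) * b i) := by
        refine Finset.sum_congr rfl fun i _ => ?_
        rw [Finset.sum_ite, Finset.sum_const, Finset.sum_const, nsmul_eq_mul, nsmul_eq_mul]
        congr 3
        · rw [hC', Finset.filter_filter]; rfl
        · rw [hC', Finset.filter_filter, cardBelow]
          congr 1
          ext x
          simp [Finset.subset_erase]
      _ ≤ ∑ i ∈ S, (a i + b i) * (F / 4) := by
        refine Finset.sum_le_sum fun i _ => ?_
        by_cases h1 : p i
        · have : ¬ q i := fun h => h.1 h1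
          have h4 : 4 * (cardBelowMem C S i : ℝ) ≤ F := by
            rw [hF]; exact_mod_cast (le_of_lt h1)
          simp only [a, b, h1, this, if_true, if_false]
          linarith
        · by_cases h2 : q i
          · have h4 : 4 * (cardBelow C (S.erase i) : ℝ) ≤ F := by
              rw [hF]; exact_mod_cast (le_of_lt h2.2)
            simp only [a, b, h1, h2, if_true, if_false]
            linarith
          · simp [a, b, h1, h2]
      _ = B / 4 * F := by rw [← Finset.sum_mul, ← hcard]; ring
  have hF' : F = ∑ _x ∈ C', (1 : ℝ) := by simp [hF, cardBelow, hC']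
  calc F ≤ ∑ x ∈ C', Real.exp (B / 4 - e x) := by
        have : ∑ x ∈ C', (B / 4 - e x + 1) ≤ ∑ x ∈ C', Real.exp (B / 4 - e x) :=
          Finset.sum_le_sum fun x _ => Real.add_one_le_exp _
        refine le_trans ?_ this
        rw [Finset.sum_add_distrib, ← hF', Finset.sum_sub_distrib, Finset.sum_const, nsmul_eq_mul]
        have : (C'.card : ℝ) = F := by simp [hF, cardBelow, hC']
        rw [this]
        linarith
    _ ≤ ∑ x ∈ S.powerset, Real.exp (B / 4 - e x) := by
        refine Finset.sum_le_sum_of_subset_of_nonneg ?_ fun _ _ _ => (Real.exp_pos _).le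
        intro x hx
        simp only [hC', Finset.mem_filter] at hx
        exact Finset.mem_powerset.2 hx.2
    _ = Real.exp (B / 4) * ∏ i ∈ S, (Real.exp (-a i) + Real.exp (-b i)) := by
        rw [Finset.prod_add, Finset.mul_sum]
        refine Finset.sum_congr rfl fun x hx => ?_
        rw [Finset.mem_powerset] at hx
        rw [← Real.exp_sum, ← Real.exp_sum, ← Real.exp_add, ← Real.exp_add]
        congr 1
        simp only [e]
        rw [Finset.sum_ite, Finset.filter_mem_eq_inter, Finset.inter_eq_right.2 hx,
          ← Finset.sdiff_eq_filter, Finset.sum_neg_distrib, Finset.sum_neg_distrib]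
        ring
    _ = ∏ i ∈ S, Real.exp ((a i + b i) / 4) * (Real.exp (-a i) + Real.exp (-b i)) := by
        rw [Finset.prod_mul_distrib, ← Real.exp_sum, ← Finset.sum_div, ← hcard]
    _ ≤ ∏ i ∈ S, 2 * (if i ∈ biased C S then (9 / 10 : ℝ) else 1) := by
        refine Finset.prod_le_prod (fun i _ => by positivity) fun i hi => ?_
        have hk := exp_quarter_mul_le
        by_cases h1 : p i
        · have : ¬ q i := fun h => h.1 h1
          have hm : i ∈ biased C S := Finset.mem_filter.2 ⟨hi, Or.inl h1⟩
          simp only [a, b, h1, this, hm, if_true, if_false]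
          norm_num at hk ⊢
          linarith
        · by_cases h2 : q i
          · have hm : i ∈ biased C S := Finset.mem_filter.2 ⟨hi, Or.inr h2.2⟩
            simp only [a, b, h1, h2, hm, if_true, if_false]
            norm_num at hk ⊢
            linarith
          · have hm : i ∉ biased C S := fun h => (Finset.mem_filter.1 h).2.elim h1
              fun h => h2 ⟨h1, h⟩
            simp only [a, b, h1, h2, hm, if_false]
            norm_num
    _ = 2 ^ S.card * (9 / 10) ^ (biased C S).card := by
        rw [Finset.prod_mul_distrib, Finset.prod_const, Finset.prod_ite, Finset.prod_const,
          Finset.prod_const_one, mul_one, Finset.filter_mem_eq_inter]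
        congr 3
        exact Finset.inter_eq_right.2 (Finset.filter_subset _ _)

lemma cardBelow_mono (C : Finset (Finset ι)) {S S' : Finset ι} (h : S ⊆ S') :
    cardBelow C S ≤ cardBelow C S' := by
  refine Finset.card_le_card fun x hx => ?_
  simp only [Finset.mem_filter] at hx ⊢
  exact ⟨hx.1, hx.2.trans h⟩

lemma cardBelow_le_two_pow (C : Finset (Finset ι)) (S : Finset ι) : cardBelow C S ≤ 2 ^ S.card := by
  rw [← Finset.card_powerset]
  refine Finset.card_le_card fun x hx => ?_
  simp only [Finset.mem_filter, Finset.mem_powerset] at hx ⊢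
  exact hx.2

lemma biased_subset (C : Finset (Finset ι)) (S : Finset ι) : biased C S ⊆ S :=
  Finset.filter_subset _ _

lemma cardBelow_le_four_mul_of_notMem_biased {C : Finset (Finset ι)} {S : Finset ι} {i : ι}
    (hi : i ∈ S) (hb : i ∉ biased C S) :
    (cardBelow C S : ℝ) ≤ 4 * cardBelowMem C S i ∧
      (cardBelow C S : ℝ) ≤ 4 * cardBelow C (S.erase i) := by
  simp only [biased, Finset.mem_filter, hi, true_and, not_or, not_lt] at hb
  exact ⟨by exact_mod_cast hb.1, by exact_mod_cast hb.2⟩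

variable [Fintype ι]

/-- The number of encodings, by pairs `(S, u)`, of disjoint pairs `(u ∩ S, u \ S)` lying in the
rectangle `C × D`. -/
noncomputable def disjointMass (C D : Finset (Finset ι)) : ℕ :=
  ((Finset.univ : Finset (Finset ι × Finset ι)).filter
    fun p => p.2 ∩ p.1 ∈ C ∧ p.2 \ p.1 ∈ D).card

/-- The number of encodings, by triples `(i, S, u)`, of pairs
`(insert i (u ∩ S), insert i (u \ S))`, which meet exactly in `i`, lying in the rectangle
`C × D`. -/
noncomputable def meetingMass (C D : Finset (Finset ι)) : ℕ :=
  ((Finset.univ : Finset (ι × Finset ι × Finset ι)).filter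
    fun p => insert p.1 (p.2.2 ∩ p.2.1) ∈ C ∧ insert p.1 (p.2.2 \ p.2.1) ∈ D).card

lemma disjointMass_eq_sum (C D : Finset (Finset ι)) :
    disjointMass C D = ∑ S : Finset ι, cardBelow C S * cardBelow D Sᶜ := by
  rw [disjointMass, Finset.card_filter, Fintype.sum_prod_type]
  refine Finset.sum_congr rfl fun S _ => ?_
  rw [← Finset.card_filter, cardBelow, cardBelow, ← Finset.card_product]
  refine Finset.card_nbij' (fun u => (u ∩ S, u \ S)) (fun q => q.1 ∪ q.2) ?_ ?_ ?_ ?_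
  · intro u hu
    simp only [Finset.coe_filter, Finset.mem_univ, true_and, Set.mem_ofPred_eq] at hu
    simp only [Finset.coe_product, Set.mem_prod, Finset.mem_coe, Finset.mem_filter]
    refine ⟨⟨hu.1, Finset.inter_subset_right⟩, hu.2, ?_⟩
    intro j hj
    simp only [Finset.mem_sdiff, Finset.mem_compl] at hj ⊢
    exact hj.2
  · rintro ⟨x, y⟩ h
    simp only [Finset.coe_product, Set.mem_prod, Finset.mem_coe, Finset.mem_filter] at h
    obtain ⟨⟨hx, hxS⟩, hy, hyS⟩ := h
    have h1 : (x ∪ y) ∩ S = x := by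
      ext j
      have := @hxS j
      have := @hyS j
      simp only [Finset.mem_inter, Finset.mem_union, Finset.mem_compl] at *
      tauto
    have h2 : (x ∪ y) \ S = y := by
      ext j
      have := @hxS j
      have := @hyS j
      simp only [Finset.mem_sdiff, Finset.mem_union, Finset.mem_compl] at *
      tauto
    simp only [Finset.coe_filter, Finset.mem_univ, true_and, Set.mem_ofPred_eq, h1, h2]
    exact ⟨hx, hy⟩
  · intro u _
    ext j
    simp only [Finset.mem_inter, Finset.mem_union, Finset.mem_sdiff]
    tauto
  · rintro ⟨x, y⟩ h
    simp only [Finset.coe_product, Set.mem_prod, Finset.mem_coe, Finset.mem_filter] at h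
    obtain ⟨⟨hx, hxS⟩, hy, hyS⟩ := h
    refine Prod.ext ?_ ?_ <;> ext j <;> have := @hxS j <;> have := @hyS j <;>
      simp only [Finset.mem_sdiff, Finset.mem_inter, Finset.mem_union, Finset.mem_compl] at * <;>
      tauto

lemma sum_cardBelowMem_mul_le_meetingMass (C D : Finset (Finset ι)) :
    ∑ S : Finset ι, ∑ i ∈ S, cardBelowMem C S i * cardBelowMem D (S.erase i)ᶜ i ≤
      meetingMass C D := by
  have key : ∀ S : Finset ι, ∀ i ∈ S, cardBelowMem C S i * cardBelowMem D (S.erase i)ᶜ i ≤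
      ∑ u : Finset ι, if insert i (u ∩ S) ∈ C ∧ insert i (u \ S) ∈ D then 1 else 0 := by
    intro S i hi
    rw [← Finset.card_filter, cardBelowMem, cardBelowMem, ← Finset.card_product]
    have hxy : ∀ q ∈ (C.filter fun x => x ⊆ S ∧ i ∈ x) ×ˢ
        (D.filter fun x => x ⊆ (S.erase i)ᶜ ∧ i ∈ x),
        insert i ((q.1 ∪ q.2.erase i) ∩ S) = q.1 ∧ insert i ((q.1 ∪ q.2.erase i) \ S) = q.2 := by
      rintro ⟨x, y⟩ h
      simp only [Finset.mem_product, Finset.mem_filter] at h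
      obtain ⟨⟨-, hxS, hix⟩, -, hyS, hiy⟩ := h
      constructor <;> ext j <;> have h1 := @hxS j <;> have h2 := @hyS j <;> by_cases hj : j = i <;>
        simp only [Finset.mem_insert, Finset.mem_inter, Finset.mem_sdiff, Finset.mem_union,
          Finset.mem_compl, Finset.mem_erase] at * <;>
        first
          | (subst hj; tauto)
          | tauto
    refine Finset.card_le_card_of_injOn (fun q => q.1 ∪ q.2.erase i) ?_ ?_
    · intro q hq
      have h := hxy q hq
      simp only [Finset.coe_filter, Finset.mem_univ, true_and, Set.mem_ofPred_eq, h.1, h.2]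
      simp only [Finset.coe_product, Set.mem_prod, Finset.mem_coe, Finset.mem_filter] at hq
      exact ⟨hq.1.1, hq.2.1⟩
    · intro q hq q' hq' h
      have h1 := hxy q hq
      have h2 := hxy q' hq'
      simp only at h
      rw [h] at h1
      exact Prod.ext (h1.1.symm.trans h2.1) (h1.2.symm.trans h2.2)
  rw [meetingMass, Finset.card_filter, Fintype.sum_prod_type, Finset.sum_congr rfl
    (fun i _ => Fintype.sum_prod_type _), Finset.sum_comm]
  refine Finset.sum_le_sum fun S _ => ?_
  refine (Finset.sum_le_sum (key S)).trans ?_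
  exact Finset.sum_le_sum_of_subset (Finset.subset_univ S)

/-- The map `(S, i) ↦ ((S.erase i)ᶜ, i)`, which exchanges the two overlapping shares, is an
involution of the pairs with `i ∈ S`. -/
lemma sum_sum_mem_erase_compl (h : Finset ι → ι → ℝ) :
    ∑ S : Finset ι, ∑ i ∈ S, h (S.erase i)ᶜ i = ∑ S : Finset ι, ∑ i ∈ S, h S i := by
  rw [Finset.sum_sigma', Finset.sum_sigma']
  refine Finset.sum_nbij' (fun p => ⟨(p.1.erase p.2)ᶜ, p.2⟩) (fun p => ⟨(p.1.erase p.2)ᶜ, p.2⟩)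
    ?_ ?_ ?_ ?_ ?_
  · intro p _; simp
  · intro p _; simp
  · rintro ⟨S, i⟩ hp
    simp only [Finset.mem_sigma, Finset.mem_univ, true_and] at hp
    simpa using hp
  · rintro ⟨S, i⟩ hp
    simp only [Finset.mem_sigma, Finset.mem_univ, true_and] at hp
    simpa using hp
  · intro p _; rfl

/-- Up to an exponentially small error, a rectangle may be treated as if each of its sides had at
most `N / 36` biased points: where there are more, that side is small by
`cardBelow_le_of_biased`. -/
lemma card_biased_mul_le (C D : Finset (Finset ι)) (S : Finset ι) :
    ((biased C S).card : ℝ) * (cardBelow C S * cardBelow D Sᶜ) ≤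
      Fintype.card ι / 36 * (cardBelow C S * cardBelow D Sᶜ) +
        Fintype.card ι * 2 ^ Fintype.card ι * (9 / 10) ^ (Fintype.card ι / 36) := by
  have hF : (0 : ℝ) ≤ cardBelow C S := Nat.cast_nonneg _
  have hG : (0 : ℝ) ≤ cardBelow D Sᶜ := Nat.cast_nonneg _
  by_cases h : 36 * (biased C S).card ≤ Fintype.card ι
  · have h' : ((biased C S).card : ℝ) ≤ Fintype.card ι / 36 := by
      rw [le_div_iff₀ (by norm_num)]
      exact_mod_cast (mul_comm _ _).trans_le h
    have := mul_le_mul_of_nonneg_right h' (mul_nonneg hF hG)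
    have : (0 : ℝ) ≤ Fintype.card ι * 2 ^ Fintype.card ι * (9 / 10) ^ (Fintype.card ι / 36) := by
      positivity
    linarith
  · have h1 : (cardBelow C S : ℝ) ≤ 2 ^ S.card * (9 / 10) ^ (Fintype.card ι / 36) := by
      refine (cardBelow_le_of_biased C S).trans ?_
      refine mul_le_mul_of_nonneg_left ?_ (by positivity)
      exact pow_le_pow_of_le_one (by norm_num) (by norm_num) (by omega)
    have h2 : (cardBelow D Sᶜ : ℝ) ≤ 2 ^ Sᶜ.card := by exact_mod_cast cardBelow_le_two_pow D Sᶜ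
    have h3 : ((biased C S).card : ℝ) ≤ Fintype.card ι := by
      exact_mod_cast Finset.card_le_univ _
    have h4 : (2 : ℝ) ^ Fintype.card ι = 2 ^ S.card * 2 ^ Sᶜ.card := by
      rw [← pow_add, Finset.card_add_card_compl]
    have h5 : (cardBelow C S : ℝ) * cardBelow D Sᶜ ≤
        (2 ^ S.card * (9 / 10) ^ (Fintype.card ι / 36)) * 2 ^ Sᶜ.card :=
      mul_le_mul h1 h2 hG (by positivity)
    have h6 := mul_le_mul h3 h5 (mul_nonneg hF hG) (Nat.cast_nonneg _)
    have h7 : (0 : ℝ) ≤ Fintype.card ι / 36 * (cardBelow C S * cardBelow D Sᶜ) := by positivity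
    rw [h4]
    linarith

/-- The corruption bound for set disjointness: a rectangle that carries a non-negligible share of
the disjoint pairs carries a constant fraction of that share of the pairs meeting in one point.
For `i ∈ S`, the shares `S` and `(S.erase i)ᶜ` overlap exactly in `i`. Unless `i` is biased for one
of the sides, requiring `i` to belong to both sets, or forbidding it to belong to one of them,
changes the weight of the rectangle by a bounded factor only; and in the latter case the
inputs are disjoint. -/
theorem disjointMass_le_meetingMass (C D : Finset (Finset ι)) :
    (Fintype.card ι : ℝ) / 64 * disjointMass C D -
        Fintype.card ι * 4 ^ Fintype.card ι * (9 / 10) ^ (Fintype.card ι / 36) ≤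
      meetingMass C D := by
  set N := Fintype.card ι with hN
  set E : ℝ := N * 4 ^ N * (9 / 10) ^ (N / 36) with hE
  -- the weight of the disjoint pairs with shares `S` and `Sᶜ`
  let W : Finset ι → ℝ := fun S => cardBelow C S * cardBelow D Sᶜ
  let bx : Finset ι → ι → ℝ := fun S i => if i ∈ biased C S then 1 else 0
  let cy : Finset ι → ι → ℝ := fun S i => if i ∈ biased D S then 1 else 0
  have hM0 : (disjointMass C D : ℝ) = ∑ S, W S := by
    rw [disjointMass_eq_sum]; push_cast; rfl
  have hM0' : (disjointMass C D : ℝ) = ∑ S : Finset ι, W Sᶜ := by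
    rw [hM0]
    exact (Equiv.sum_comp (Equiv.ofBijective _ (compl_bijective (α := Finset ι))) W).symm
  -- if `i` is biased for a side, the left hand side is nonpositive; otherwise both weights are at
  -- most `16` times the product on the right
  have hpair : ∀ S : Finset ι, ∀ i ∈ S,
      (W S - 5 * (bx S i * W S)) + (W (S.erase i) - 5 * (cy (S.erase i)ᶜ i * W (S.erase i)))
        ≤ 32 * (cardBelowMem C S i * cardBelowMem D (S.erase i)ᶜ i : ℝ) := by
    intro S i hi
    have hi' : i ∈ (S.erase i)ᶜ := by simp
    have hS' : (S.erase i)ᶜ.erase i = Sᶜ := by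
      ext j
      by_cases hj : j = i
      · subst hj; simp [hi]
      · simp [hj]
    have f0 : (cardBelow C (S.erase i) : ℝ) ≤ cardBelow C S := by
      exact_mod_cast cardBelow_mono C (Finset.erase_subset i S)
    have g0 : (cardBelow D Sᶜ : ℝ) ≤ cardBelow D (S.erase i)ᶜ := by
      have := cardBelow_mono D (Finset.erase_subset i (S.erase i)ᶜ)
      rw [hS'] at this
      exact_mod_cast this
    have hb := @cardBelow_le_four_mul_of_notMem_biased _ _ C S i hi
    have hc := @cardBelow_le_four_mul_of_notMem_biased _ _ D (S.erase i)ᶜ i hi'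
    rw [hS'] at hc
    have p1 : (0 : ℝ) ≤ cardBelow C S := Nat.cast_nonneg _
    have p2 : (0 : ℝ) ≤ cardBelow D Sᶜ := Nat.cast_nonneg _
    have p3 : (0 : ℝ) ≤ cardBelow C (S.erase i) := Nat.cast_nonneg _
    have p4 : (0 : ℝ) ≤ cardBelow D (S.erase i)ᶜ := Nat.cast_nonneg _
    have p5 : (0 : ℝ) ≤ cardBelowMem C S i := Nat.cast_nonneg _
    have p6 : (0 : ℝ) ≤ cardBelowMem D (S.erase i)ᶜ i := Nat.cast_nonneg _
    simp only [W, bx, cy]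
    generalize (cardBelow C S : ℝ) = F at *
    generalize (cardBelow D Sᶜ : ℝ) = G at *
    generalize (cardBelow C (S.erase i) : ℝ) = F' at *
    generalize (cardBelow D (S.erase i)ᶜ : ℝ) = G' at *
    generalize (cardBelowMem C S i : ℝ) = F1 at *
    generalize (cardBelowMem D (S.erase i)ᶜ i : ℝ) = G1 at *
    have q1 : 0 ≤ F1 * G1 := mul_nonneg p5 p6
    have q2 : F' * G ≤ F * G := mul_le_mul_of_nonneg_right f0 p2
    have q3 : F' * G ≤ F' * G' := mul_le_mul_of_nonneg_left g0 p3
    have q4 : 0 ≤ F' * G := mul_nonneg p3 p2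
    by_cases h1 : i ∈ biased C S <;> by_cases h2 : i ∈ biased D (S.erase i)ᶜ <;>
      simp only [h1, h2, if_true, if_false]
    · linarith
    · have := mul_le_mul_of_nonneg_left (hc h2).2 p3
      linarith
    · have := mul_le_mul_of_nonneg_right (hb h1).2 p2
      linarith
    · have r1 : F * G ≤ 16 * (F1 * G1) := by
        have := mul_le_mul (hb h1).1 (g0.trans (hc h2).1) p2 (by linarith)
        linarith
      have r2 : F' * G' ≤ 16 * (F1 * G1) := by
        have := mul_le_mul (f0.trans (hb h1).1) (hc h2).1 p4 (by linarith)
        linarith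
      linarith
  have hsum := Finset.sum_le_sum fun S (_ : S ∈ Finset.univ) => Finset.sum_le_sum (hpair S)
  have hbx : ∀ S : Finset ι, ∑ i ∈ S, bx S i = (biased C S).card := by
    intro S
    simp only [bx]
    rw [← Finset.sum_filter, Finset.filter_mem_eq_inter,
      Finset.inter_eq_right.2 (biased_subset C S)]
    simp
  have hcy : ∀ S : Finset ι, ∑ i ∈ S, cy S i = (biased D S).card := by
    intro S
    simp only [cy]
    rw [← Finset.sum_filter, Finset.filter_mem_eq_inter,
      Finset.inter_eq_right.2 (biased_subset D S)]
    simp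
  -- summing over the pairs `(S, i)`, the two weights are counted `S.card` and `Sᶜ.card` times, so
  -- that no lower bound on `S.card` is needed
  have hre := sum_sum_mem_erase_compl fun S i => W Sᶜ - 5 * (cy S i * W Sᶜ)
  simp only [compl_compl] at hre
  simp only [Finset.sum_add_distrib] at hsum
  rw [hre] at hsum
  simp only [Finset.sum_sub_distrib, Finset.sum_const, nsmul_eq_mul, ← Finset.mul_sum,
    ← Finset.sum_mul, hbx, hcy] at hsum
  have hP : ∑ S : Finset ι, ∑ i ∈ S, (cardBelowMem C S i * cardBelowMem D (S.erase i)ᶜ i : ℝ) ≤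
      meetingMass C D := by
    exact_mod_cast sum_cardBelowMem_mul_le_meetingMass C D
  have hN1 : ∑ S : Finset ι, (S.card : ℝ) * W S + ∑ S : Finset ι, (S.card : ℝ) * W Sᶜ =
      N * disjointMass C D := by
    have : ∑ S : Finset ι, (S.card : ℝ) * W Sᶜ = ∑ S : Finset ι, (Sᶜ.card : ℝ) * W S := by
      rw [← Equiv.sum_comp (Equiv.ofBijective _ (compl_bijective (α := Finset ι)))]
      simp
    rw [this, ← Finset.sum_add_distrib, hM0, Finset.mul_sum]
    refine Finset.sum_congr rfl fun S _ => ?_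
    rw [← add_mul, ← Nat.cast_add, Finset.card_add_card_compl]
  have hconst : ∑ _S : Finset ι, ((N : ℝ) * 2 ^ N * (9 / 10) ^ (N / 36)) = E := by
    rw [Finset.sum_const, Finset.card_univ, Fintype.card_finset, nsmul_eq_mul, hE]
    have : (4 : ℝ) ^ N = 2 ^ N * 2 ^ N := by rw [← mul_pow]; norm_num
    rw [this]
    push_cast
    ring
  have hBx : ∑ S : Finset ι, ((biased C S).card : ℝ) * W S ≤ N / 36 * disjointMass C D + E := by
    rw [hM0, ← hconst, Finset.mul_sum, ← Finset.sum_add_distrib]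
    exact Finset.sum_le_sum fun S _ => card_biased_mul_le C D S
  have hBy : ∑ S : Finset ι, ((biased D S).card : ℝ) * W Sᶜ ≤ N / 36 * disjointMass C D + E := by
    rw [hM0', ← hconst, Finset.mul_sum, ← Finset.sum_add_distrib]
    refine Finset.sum_le_sum fun S _ => ?_
    have := card_biased_mul_le D C S
    simp only [W, compl_compl]
    rw [mul_comm (cardBelow C Sᶜ : ℝ)]
    exact this
  have hpos : (0 : ℝ) ≤ N * disjointMass C D := by positivity
  have hE0 : 0 ≤ E := by positivity
  linarith

end Corruption

/-! ### Protocols with one-sided error -/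

section Transcripts

variable {ι : Type*} [DecidableEq ι] [Fintype ι]

open Classical in
/-- A protocol for two parties holding `x` and `y` is recorded by its transcripts `τ x y`: the
inputs with a given transcript form a rectangle.  If the verdict `found`, read off from the
transcript, is never positive on disjoint sets and is negative for at most a fraction `1 / 243`
of the encodings of pairs of sets meeting in one point, there are exponentially many
transcripts. -/
theorem card_transcripts_ge [Nonempty ι] {R : Type*} [Fintype R]
    (τ : Finset ι → Finset ι → R)
    (hrect : ∀ x y x' y', τ x y = τ x' y' → τ x y' = τ x y)
    (found : R → Prop) (hdisj : ∀ x y, Disjoint x y → ¬ found (τ x y))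
    (herr : 243 * ((Finset.univ : Finset (ι × Finset ι × Finset ι)).filter fun p =>
      ¬ found (τ (insert p.1 (p.2.2 ∩ p.2.1)) (insert p.1 (p.2.2 \ p.2.1)))).card ≤
        Fintype.card ι * 4 ^ Fintype.card ι) :
    (1 / 128 : ℝ) ≤ Fintype.card R * (9 / 10) ^ (Fintype.card ι / 36) := by
  -- the rectangle of the inputs with transcript `r`
  let C : R → Finset (Finset ι) := fun r => Finset.univ.filter fun x => ∃ y, τ x y = r
  let D : R → Finset (Finset ι) := fun r => Finset.univ.filter fun y => ∃ x, τ x y = r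
  let B : Finset R := Finset.univ.filter fun r => ¬ found r
  have hCD : ∀ x y r, x ∈ C r ∧ y ∈ D r ↔ τ x y = r := by
    intro x y r
    simp only [C, D, Finset.mem_filter, Finset.mem_univ, true_and]
    constructor
    · rintro ⟨⟨y', h⟩, x', h'⟩
      rw [hrect x y' x' y (h.trans h'.symm), h]
    · intro h
      exact ⟨⟨y, h⟩, x, h⟩
  have h0 : ∑ r ∈ B, disjointMass (C r) (D r) = 4 ^ Fintype.card ι := by
    have := Finset.card_eq_sum_card_fiberwise (s := (Finset.univ : Finset (Finset ι × Finset ι)))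
      (t := B) (f := fun p => τ (p.2 ∩ p.1) (p.2 \ p.1)) (by
        intro p _
        simp only [B, Finset.coe_filter, Finset.mem_univ, true_and, Set.mem_ofPred_eq]
        refine hdisj _ _ ?_
        rw [Finset.disjoint_left]
        intro j hj hj'
        exact (Finset.mem_sdiff.1 hj').2 (Finset.mem_inter.1 hj).2)
    rw [Finset.card_univ, Fintype.card_prod, Fintype.card_finset, ← mul_pow] at this
    rw [show (4 : ℕ) = 2 * 2 from rfl, this]
    refine Finset.sum_congr rfl fun r _ => ?_
    rw [disjointMass]
    simp only [hCD]
  have h1 : ∑ r ∈ B, meetingMass (C r) (D r) =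
      ((Finset.univ : Finset (ι × Finset ι × Finset ι)).filter fun p =>
      ¬ found (τ (insert p.1 (p.2.2 ∩ p.2.1)) (insert p.1 (p.2.2 \ p.2.1)))).card := by
    rw [Finset.card_eq_sum_card_fiberwise (t := B)
      (f := fun p => τ (insert p.1 (p.2.2 ∩ p.2.1)) (insert p.1 (p.2.2 \ p.2.1)))
      (fun p hp => by simpa [B] using hp)]
    refine Finset.sum_congr rfl fun r hr => ?_
    rw [meetingMass, Finset.filter_filter]
    congr 1
    refine Finset.filter_congr fun p _ => ?_
    rw [hCD]
    constructor
    · intro h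
      rw [h]
      exact ⟨(Finset.mem_filter.1 hr).2, rfl⟩
    · exact fun h => h.2
  rw [← h1] at herr
  have h2 := Finset.sum_le_sum fun r (_ : r ∈ B) => disjointMass_le_meetingMass (C r) (D r)
  rw [Finset.sum_sub_distrib, ← Finset.mul_sum, Finset.sum_const, nsmul_eq_mul, ← Nat.cast_sum,
    h0, ← Nat.cast_sum] at h2
  have herr' : (243 : ℝ) * ((∑ r ∈ B, meetingMass (C r) (D r) : ℕ) : ℝ) ≤
      Fintype.card ι * 4 ^ Fintype.card ι := by exact_mod_cast herr
  have hB : (B.card : ℝ) ≤ Fintype.card R := by exact_mod_cast Finset.card_le_univ B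
  set K : ℝ := Fintype.card ι * 4 ^ Fintype.card ι with hK
  have hKpos : 0 < K := by
    have : 0 < Fintype.card ι := Fintype.card_pos
    positivity
  set l : ℝ := (9 / 10) ^ (Fintype.card ι / 36) with hl
  have hlpos : 0 < l := by positivity
  have h3 : (B.card : ℝ) * (K * l) ≤ Fintype.card R * (K * l) :=
    mul_le_mul_of_nonneg_right hB (by positivity)
  have h4 : K * (1 / 128) ≤ K * (Fintype.card R * l) := by
    push_cast at h2
    have e1 : (Fintype.card ι : ℝ) / 64 * 4 ^ Fintype.card ι = K / 64 := by rw [hK]; ring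
    rw [e1] at h2
    push_cast at herr'
    nlinarith
  exact le_of_mul_le_mul_left h4 hKpos

end Transcripts

section Averaging

open Classical in
/-- Fixing random strings one after another: if each of finitely many events has probability at
least `2 / 3`, then for every `t` there are `t` sample points such that at most a fraction `3⁻ᵗ`
of the events contains none of them. -/
lemma exists_sample_points {Ω κ : Type*} [MeasurableSpace Ω] (μ : Measure Ω)
    [IsProbabilityMeasure μ] (s : Finset κ) (E : κ → Set Ω) (hE : ∀ k ∈ s, MeasurableSet (E k))
    (hp : ∀ k ∈ s, (2 / 3 : ℝ≥0∞) ≤ μ (E k)) (t : ℕ) :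
    ∃ ρ : Fin t → Ω, 3 ^ t * (s.filter fun k => ∀ j, ρ j ∉ E k).card ≤ s.card := by
  induction t with
  | zero => exact ⟨Fin.elim0, by simp⟩
  | succ t ih =>
    obtain ⟨ρ, hρ⟩ := ih
    set s' := s.filter fun k => ∀ j, ρ j ∉ E k with hs'
    obtain ⟨ω, hω⟩ : ∃ ω, 3 * (s'.filter fun k => ω ∉ E k).card ≤ s'.card := by
      by_contra! hcon
      have hs0 : (s'.card : ℝ≥0∞) ≠ ⊤ := ENNReal.natCast_ne_top _
      have hcard : ∀ ω, (s'.card : ℝ≥0∞) + 1 ≤ 3 * ∑ k ∈ s', (E k)ᶜ.indicator 1 ω := by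
        intro ω
        have h := hcon ω
        have : ∑ k ∈ s', (E k)ᶜ.indicator (1 : Ω → ℝ≥0∞) ω =
            ((s'.filter fun k => ω ∉ E k).card : ℝ≥0∞) := by
          rw [Finset.card_filter]
          push_cast
          refine Finset.sum_congr rfl fun k _ => ?_
          by_cases hk : ω ∈ E k <;> simp [hk]
        rw [this]
        exact_mod_cast h
      have hint := lintegral_mono (μ := μ) hcard
      have hmeas : ∀ k ∈ s', MeasurableSet (E k)ᶜ := fun k hk =>
        (hE k (Finset.mem_filter.1 hk).1).compl
      rw [lintegral_const, measure_univ, mul_one, lintegral_const_mul' _ _ (by norm_num),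
        lintegral_finsetSum' _ fun k hk =>
          (measurable_one.indicator (hmeas k hk)).aemeasurable] at hint
      have hle : ∑ k ∈ s', ∫⁻ ω, (E k)ᶜ.indicator 1 ω ∂μ ≤ ∑ _k ∈ s', (1 / 3 : ℝ≥0∞) := by
        refine Finset.sum_le_sum fun k hk => ?_
        rw [lintegral_indicator_one (hmeas k hk),
          prob_compl_eq_one_sub (hE k (Finset.mem_filter.1 hk).1)]
        refine (tsub_le_tsub_left (hp k (Finset.mem_filter.1 hk).1) 1).trans ?_
        rw [tsub_le_iff_right, ENNReal.div_add_div_same]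
        norm_num
        rw [ENNReal.div_self] <;> norm_num
      have h3 := hint.trans (mul_le_mul_right hle 3)
      rw [Finset.sum_const, nsmul_eq_mul, mul_left_comm,
        ENNReal.mul_div_cancel (by norm_num) (by norm_num), mul_one] at h3
      have : s'.card + 1 ≤ s'.card := by exact_mod_cast h3
      omega
    refine ⟨Fin.snoc ρ ω, ?_⟩
    have : (s.filter fun k => ∀ j, (Fin.snoc ρ ω : Fin (t + 1) → Ω) j ∉ E k) =
        s'.filter fun k => ω ∉ E k := by
      rw [hs', Finset.filter_filter]
      refine Finset.filter_congr fun k _ => ?_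
      rw [Fin.forall_fin_succ']
      simp
    rw [this, pow_succ, mul_assoc]
    exact (Nat.mul_le_mul_left _ hω).trans hρ

end Averaging

/-! ### The lower bound network -/

/-- The nodes of the lower bound network for sets `x, y ⊆ Fin N`, with labels of `L` bits and `P`
padding nodes: the `candidate`s for a center, the `checker`s that test them, the `bit` nodes for
every bit position and bit value on the side of the candidates (`false`) and of the checkers
(`true`), a `hub` adjacent to all candidates, and a `tail` (a path with three nodes) whose first
node is adjacent to the candidates in `x`. -/
inductive Node (N L P : ℕ) : Type
  | candidate (i : Fin N)
  | checker (j : Fin N)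
  | bit (side : Bool) (h : Fin L) (e : Bool)
  | tail (k : Fin 3)
  | hub
  | pad (p : Fin P)

namespace Node

variable {N L P : ℕ}

/-- `Node N L P` as a sum of standard finite types. -/
def equivSum (N L P : ℕ) :
    Node N L P ≃ Fin N ⊕ Fin N ⊕ (Bool × Fin L × Bool) ⊕ Fin 3 ⊕ Unit ⊕ Fin P where
  toFun
    | candidate i => .inl i
    | checker j => .inr (.inl j)
    | bit s h e => .inr (.inr (.inl (s, h, e)))
    | tail k => .inr (.inr (.inr (.inl k)))
    | hub => .inr (.inr (.inr (.inr (.inl ()))))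
    | pad p => .inr (.inr (.inr (.inr (.inr p))))
  invFun
    | .inl i => candidate i
    | .inr (.inl j) => checker j
    | .inr (.inr (.inl (s, h, e))) => bit s h e
    | .inr (.inr (.inr (.inl k))) => tail k
    | .inr (.inr (.inr (.inr (.inl _)))) => hub
    | .inr (.inr (.inr (.inr (.inr p)))) => pad p
  left_inv v := by cases v <;> rfl
  right_inv v := by rcases v with i | j | ⟨s, h, e⟩ | k | _ | p <;> rfl

lemma exists_equiv_fin {N L P n : ℕ} (h : N + N + 4 * L + 4 + P = n) :
    Nonempty (Fin n ≃ Node N L P) := by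
  let _ : Fintype (Node N L P) := Fintype.ofEquiv _ (equivSum N L P).symm
  refine ⟨(Fintype.equivFinOfCardEq ?_).symm⟩
  rw [Fintype.card_congr (equivSum N L P)]
  simp only [Fintype.card_sum, Fintype.card_prod, Fintype.card_fin, Fintype.card_bool,
    Fintype.card_unit]
  omega

/-- The edges of the network, each oriented in one direction.  Candidate `i` is adjacent to the bit
nodes of its own label, checker `j` to those of the complementary label, and to all of them if
`j ∈ y`; only the edges at candidates depend on `x`, and only the edges at checkers depend
on `y`. -/
def Link (x y : Finset (Fin N)) : Node N L P → Node N L P → Prop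
  | candidate i, tail k => k = 0 ∧ i ∈ x
  | candidate _, hub => True
  | candidate i, bit s h e => s = false ∧ (i : ℕ).testBit h = e
  | tail k, tail k' => (k : ℕ) + 1 = k'
  | hub, bit s _ _ => s = false
  | hub, pad _ => True
  | bit s h e, bit s' h' e' => s = false ∧ s' = true ∧ h = h' ∧ e = e'
  | bit s h e, checker j => s = true ∧ (j ∈ y ∨ (j : ℕ).testBit h ≠ e)
  | _, _ => False

/-- The lower bound network. -/
def network (L P : ℕ) (x y : Finset (Fin N)) : SimpleGraph (Node N L P) :=
  SimpleGraph.fromRel (Link x y)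

lemma adj_of_link {x y : Finset (Fin N)} {u v : Node N L P} (h : Link x y u v) :
    (network L P x y).Adj u v := by
  refine (SimpleGraph.fromRel_adj _ _ _).2 ⟨?_, Or.inl h⟩
  rintro rfl
  cases u <;> simp [Link] at h

/-- The side of a node in the two-party simulation: the checkers and their bit nodes are simulated
by the party that knows `y`, all other nodes by the party that knows `x`. -/
def onCheckerSide : Node N L P → Bool
  | checker _ => true
  | bit s _ _ => s
  | _ => false

lemma adj_iff_of_onCheckerSide_eq_false {x y y' : Finset (Fin N)} {u v : Node N L P}
    (hv : onCheckerSide v = false) :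
    (network L P x y).Adj u v ↔ (network L P x y').Adj u v := by
  simp only [network, SimpleGraph.fromRel_adj]
  cases u <;> cases v <;> simp_all [Link, onCheckerSide]

lemma adj_iff_of_onCheckerSide_eq_true {x x' y : Finset (Fin N)} {u v : Node N L P}
    (hv : onCheckerSide v = true) :
    (network L P x y).Adj u v ↔ (network L P x' y).Adj u v := by
  simp only [network, SimpleGraph.fromRel_adj]
  cases u <;> cases v <;> simp_all [Link, onCheckerSide]

lemma exists_bit_of_adj {x y : Finset (Fin N)} {u v : Node N L P}
    (h : (network L P x y).Adj u v) (hs : onCheckerSide u ≠ onCheckerSide v) :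
    ∃ (s : Bool) (k : Fin L) (e : Bool), u = bit s k e ∧ v = bit (!s) k e := by
  simp only [network, SimpleGraph.fromRel_adj] at h
  cases u <;> cases v <;> simp_all [Link, onCheckerSide]
  rcases h with ⟨rfl, rfl, rfl, rfl⟩ | ⟨rfl, rfl, rfl, rfl⟩ <;>
    simp <;> cases ‹Bool› <;> simp

/-- A function that grows by at most one along edges bounds distances from below. -/
lemma _root_.SimpleGraph.le_add_edist_of_adj {V : Type*} {G : SimpleGraph V} {f : V → ℕ}
    (hf : ∀ u v, G.Adj u v → f u ≤ f v + 1) (u v : V) : (f u : ℕ∞) ≤ f v + G.edist u v := by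
  by_cases h : G.Reachable u v
  · obtain ⟨p, hp⟩ := h.exists_walk_length_eq_edist
    rw [← hp]
    have : ∀ {u v : V} (p : G.Walk u v), f u ≤ f v + p.length := by
      intro u v p
      induction p with
      | nil => simp
      | cons h p ih =>
        have := hf _ _ h
        simp only [SimpleGraph.Walk.length_cons]
        omega
    exact_mod_cast this p
  · rw [SimpleGraph.edist_eq_top_of_not_reachable h]
    simp

lemma le_add_edist_of_link {x y : Finset (Fin N)} {f : Node N L P → ℕ}
    (hf : ∀ u v, Link x y u v → f u ≤ f v + 1 ∧ f v ≤ f u + 1) (u v : Node N L P) :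
    (f u : ℕ∞) ≤ f v + (network L P x y).edist u v := by
  refine SimpleGraph.le_add_edist_of_adj (fun u v h => ?_) u v
  rcases ((SimpleGraph.fromRel_adj _ _ _).1 h).2 with h | h
  · exact (hf u v h).1
  · exact (hf v u h).2

open Classical in
/-- A lower bound for the distance to the end of the tail. -/
noncomputable def height (x : Finset (Fin N)) : Node N L P → ℕ
  | tail k => 2 - k
  | candidate i => if i ∈ x then 3 else 4
  | hub => 4
  | bit false _ _ => 4
  | bit true _ _ => 5
  | pad _ => 5
  | checker _ => 6

lemma height_link (x y : Finset (Fin N)) (u v : Node N L P) (h : Link x y u v) :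
    height x u ≤ height x v + 1 ∧ height x v ≤ height x u + 1 := by
  cases u <;> cases v <;> simp_all [Link, height] <;>
    first | done | omega | (split_ifs <;> simp)

/-- A lower bound for the distance to the checker `i`, when `i ∉ y`. -/
noncomputable def checkerHeight (i : Fin N) : Node N L P → ℕ
  | checker j => if j = i then 0 else 2
  | bit true h e => if (i : ℕ).testBit h = e then 2 else 1
  | bit false h e => if (i : ℕ).testBit h = e then 3 else 2
  | candidate j => if j = i then 4 else 3
  | hub => 3
  | tail _ => 4
  | pad _ => 4

lemma checkerHeight_link {x y : Finset (Fin N)} {i : Fin N} (hi : i ∉ y) (u v : Node N L P)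
    (h : Link x y u v) :
    checkerHeight i u ≤ checkerHeight i v + 1 ∧ checkerHeight i v ≤ checkerHeight i u + 1 := by
  cases u <;> cases v <;> simp_all [Link, checkerHeight]
  all_goals split_ifs <;> simp_all

lemma edist_le_succ_of_link {x y : Finset (Fin N)} {u v w : Node N L P} {k : ℕ∞}
    (h : Link x y u v ∨ Link x y v u) (hv : (network L P x y).edist v w ≤ k) :
    (network L P x y).edist u w ≤ k + 1 := by
  have hadj : (network L P x y).Adj u v := h.elim adj_of_link fun h => (adj_of_link h).symm
  have h1 := SimpleGraph.edist_le_one_iff_adj_or_eq.2 (Or.inl hadj)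
  refine (SimpleGraph.edist_triangle (v := v)).trans ?_
  rw [add_comm]
  exact add_le_add hv h1

/-- A candidate in both sets is within distance `3` of all nodes. -/
lemma edist_candidate_le {x y : Finset (Fin N)} {i : Fin N} (hx : i ∈ x) (hy : i ∈ y)
    (hL : 0 < L) (hN : N ≤ 2 ^ L) (u : Node N L P) :
    (network L P x y).edist u (candidate i) ≤ 3 := by
  have h0 : (network L P x y).edist (candidate i) (candidate i) ≤ 0 := by simp
  have hhub : (network L P x y).edist hub (candidate i) ≤ 0 + 1 :=
    edist_le_succ_of_link (Or.inr (by simp [Link])) h0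
  have hbit : ∀ h : Fin L, (network L P x y).edist (bit false h ((i : ℕ).testBit h))
      (candidate i) ≤ 0 + 1 :=
    fun h => edist_le_succ_of_link (Or.inr (by simp [Link])) h0
  have hbit' : ∀ h : Fin L, (network L P x y).edist (bit true h ((i : ℕ).testBit h))
      (candidate i) ≤ 0 + 1 + 1 :=
    fun h => edist_le_succ_of_link (Or.inr (by simp [Link])) (hbit h)
  have hfalse : ∀ (h : Fin L) (e : Bool), (network L P x y).edist (bit false h e)
      (candidate i) ≤ 0 + 1 + 1 :=
    fun h e => edist_le_succ_of_link (Or.inr (by simp [Link])) hhub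
  have ht0 : (network L P x y).edist (tail 0) (candidate i) ≤ 0 + 1 :=
    edist_le_succ_of_link (Or.inr (by simp [Link, hx])) h0
  have ht1 : (network L P x y).edist (tail 1) (candidate i) ≤ 0 + 1 + 1 :=
    edist_le_succ_of_link (Or.inr (by simp [Link])) ht0
  have ht2 : (network L P x y).edist (tail 2) (candidate i) ≤ 0 + 1 + 1 + 1 :=
    edist_le_succ_of_link (Or.inr (by simp [Link])) ht1
  have e2 : (0 + 1 + 1 : ℕ∞) ≤ 3 := by norm_num
  have e1 : (0 + 1 : ℕ∞) ≤ 3 := by norm_num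
  have e3 : (0 + 1 + 1 + 1 : ℕ∞) ≤ 3 := by norm_num
  cases u with
  | candidate j => exact (edist_le_succ_of_link (Or.inl (by simp [Link])) hhub).trans e2
  | checker j =>
    have : ∃ h : Fin L, j ∈ y ∨ (j : ℕ).testBit h ≠ (i : ℕ).testBit h := by
      by_cases hij : j = i
      · exact ⟨⟨0, hL⟩, Or.inl (hij ▸ hy)⟩
      · by_contra! hcon
        refine hij (Fin.ext (Nat.eq_of_testBit_eq fun k => ?_))
        by_cases hk : k < L
        · exact (hcon ⟨k, hk⟩).2
        · have hpow : 2 ^ L ≤ 2 ^ k := Nat.pow_le_pow_right (by norm_num) (by omega)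
          rw [Nat.testBit_lt_two_pow (by omega), Nat.testBit_lt_two_pow (by omega)]
    obtain ⟨h, hh⟩ := this
    have hlink : Link x y (bit true h ((i : ℕ).testBit h) : Node N L P) (checker j) := ⟨rfl, hh⟩
    exact (edist_le_succ_of_link (Or.inr hlink) (hbit' h)).trans e3
  | bit s h e =>
    cases s with
    | false => exact (hfalse h e).trans e2
    | true => exact (edist_le_succ_of_link (Or.inr (by simp [Link])) (hfalse h e)).trans e3
  | tail k =>
    fin_cases k
    · exact ht0.trans e1
    · exact ht1.trans e2
    · exact ht2.trans e3
  | hub => exact hhub.trans e1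
  | pad p => exact (edist_le_succ_of_link (Or.inr (by simp [Link])) hhub).trans e2

/-- Only candidates in both sets are within distance `3` of all nodes. -/
lemma exists_candidate_of_edist_le {x y : Finset (Fin N)} {w : Node N L P} (hN : 0 < N)
    (hw : ∀ u, (network L P x y).edist u w ≤ 3) : ∃ i, i ∈ x ∧ i ∈ y ∧ w = candidate i := by
  have h1 : ∀ (f : Node N L P → ℕ), (∀ u v, Link x y u v → f u ≤ f v + 1 ∧ f v ≤ f u + 1) →
      ∀ u, f u ≤ f w + 3 ∧ f w ≤ f u + 3 := by
    intro f hf u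
    have a := (le_add_edist_of_link hf u w).trans (add_le_add_right (hw u) _)
    have b := (le_add_edist_of_link hf w u).trans
      (add_le_add_right (SimpleGraph.edist_comm.trans_le (hw u)) _)
    exact ⟨by exact_mod_cast a, by exact_mod_cast b⟩
  have ht := (h1 (height x) (height_link x y) (tail 2)).2
  have hc := (h1 (height x) (height_link x y) (checker ⟨0, hN⟩)).1
  cases w with
  | candidate i =>
    have hx : i ∈ x := by
      by_contra hx
      simp [height, hx] at ht
    refine ⟨i, hx, ?_, rfl⟩
    -- otherwise checker `i` is at distance at least `4`
    by_contra hy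
    have := (h1 _ (checkerHeight_link hy) (checker i)).2
    simp [checkerHeight] at this
  | checker j => simp [height] at ht
  | bit s h e => cases s <;> simp [height] at ht
  | tail k => simp only [height] at hc; omega
  | hub => simp [height] at ht
  | pad p => simp [height] at ht

lemma _root_.SimpleGraph.edist_map_le {V W : Type*} {G : SimpleGraph V} {H : SimpleGraph W}
    (f : G →g H) (u v : V) : H.edist (f u) (f v) ≤ G.edist u v := by
  by_cases h : G.Reachable u v
  · obtain ⟨p, hp⟩ := h.exists_walk_length_eq_edist
    rw [← hp, ← SimpleGraph.Walk.length_map f p]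
    exact SimpleGraph.edist_le _
  · rw [SimpleGraph.edist_eq_top_of_not_reachable h]
    exact le_top

lemma _root_.SimpleGraph.edist_comap {V W : Type*} (e : V ≃ W) (H : SimpleGraph W) (u v : V) :
    (H.comap e).edist u v = H.edist (e u) (e v) := by
  refine le_antisymm ?_ (SimpleGraph.edist_map_le (SimpleGraph.Iso.comap e H).toHom u v)
  have := SimpleGraph.edist_map_le (SimpleGraph.Iso.comap e H).symm.toHom (e u) (e v)
  simpa using this

lemma network_comap_connected {n : ℕ} (σ : Fin n ≃ Node N L P) {x y : Finset (Fin N)} {i : Fin N}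
    (hx : i ∈ x) (hy : i ∈ y) (hL : 0 < L) (hN : N ≤ 2 ^ L) :
    ((network L P x y).comap σ).Connected := by
  refine SimpleGraph.connected_iff_exists_forall_reachable _ |>.2
    ⟨σ.symm (candidate i), fun u => ?_⟩
  refine (SimpleGraph.reachable_of_edist_ne_top (ne_top_of_le_ne_top (b := 3) (by simp) ?_)).symm
  rw [SimpleGraph.edist_comap]
  simpa using edist_candidate_le hx hy hL hN (σ u)

/-- On the network of two meeting sets the optimum is at most `3`, so an approximation with a
factor below `4 / 3` is a single candidate, and it belongs to both sets. -/
lemma eq_singleton_of_isApprox {n : ℕ} (σ : Fin n ≃ Node N L P) {x y : Finset (Fin N)} {i : Fin N}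
    (hx : i ∈ x) (hy : i ∈ y) (hL : 0 < L) (hN : N ≤ 2 ^ L) {α : ℝ} (hα : α < 4 / 3)
    {S : Finset (Fin n)} (hS : KCenter.IsApprox ((network L P x y).comap σ) 1 α S) :
    ∃ j, j ∈ x ∧ j ∈ y ∧ S = {σ.symm (candidate j)} := by
  set G := (network L P x y).comap σ with hG
  have hopt : KCenter.opt G 1 ≤ 3 := by
    refine (iInf_le _ ⟨{σ.symm (candidate i)}, by simp⟩).trans ?_
    refine iSup_le fun v => ?_
    simp only [Finset.mem_singleton, iInf_iInf_eq_left]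
    rw [hG, SimpleGraph.edist_comap]
    simpa using edist_candidate_le hx hy hL hN (σ v)
  have hrad : KCenter.coverRadius G S ≤ 3 := by
    by_contra! hcon
    have h4 : (4 : ℕ∞) ≤ KCenter.coverRadius G S := by
      have := Order.add_one_le_of_lt hcon
      norm_num at this
      exact this
    have h5 : (4 : ℝ≥0∞) ≤ ENNReal.ofReal α * 3 := by
      have a : ((4 : ℕ∞) : ℝ≥0∞) ≤ (KCenter.coverRadius G S : ℝ≥0∞) :=
        ENat.toENNReal_le.2 h4
      have b : ((KCenter.opt G 1 : ℕ∞) : ℝ≥0∞) ≤ ((3 : ℕ∞) : ℝ≥0∞) := ENat.toENNReal_le.2 hopt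
      have c := a.trans (hS.2.trans (mul_le_mul_right b _))
      simpa using c
    have h6 : ENNReal.ofReal α * 3 < 4 := by
      have : ENNReal.ofReal α * 3 = ENNReal.ofReal (α * 3) := by
        rw [ENNReal.ofReal_mul' (by norm_num)]
        simp
      rw [this, show (4 : ℝ≥0∞) = ENNReal.ofReal 4 by simp]
      exact (ENNReal.ofReal_lt_ofReal_iff (by norm_num)).2 (by linarith)
    exact absurd h5 (not_le.2 h6)
  have hfar : ∀ v, ⨅ s ∈ S, G.edist v s ≤ 3 := fun v => (le_iSup _ v).trans hrad
  have hcard : S.card = 1 := by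
    refine le_antisymm hS.1 (Finset.card_pos.2 ?_)
    rw [Finset.nonempty_iff_ne_empty]
    rintro rfl
    have := hfar (σ.symm hub)
    simp at this
  obtain ⟨s, rfl⟩ := Finset.card_eq_one.1 hcard
  obtain ⟨j, hjx, hjy, hj⟩ := exists_candidate_of_edist_le (x := x) (y := y) (w := σ s)
    (Fin.pos i) fun u => by
      have := hfar (σ.symm u)
      rw [hG] at this
      simpa [SimpleGraph.edist_comap] using this
  exact ⟨j, hjx, hjy, by rw [← hj]; simp⟩

end Node

end CenterLowerBound

open CenterLowerBound

/-! ### Executions: measurability and the two-party simulation -/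

namespace Congest.Algorithm

variable {n b : ℕ} (A : Algorithm n b)

lemma message_finite (b : ℕ) : Finite (Message b) :=
  (List.finite_length_le Bool b).to_subtype

/-- States after `t` rounds are measurable functions of the tapes: there are only finitely many
inboxes, and on each event that fixes the inbox the step is measurable. -/
lemma measurable_run (G : SimpleGraph (Fin n)) (t : ℕ) (v : Fin n) :
    @Measurable _ _ _ A.measurableSpaceState fun ρ => A.run G ρ t v := by
  classical
  let _ := A.measurableSpaceState
  have := message_finite b
  induction t generalizing v with
  | zero => exact (A.measurable_start v _).comp (measurable_pi_apply v)
  | succ t ih =>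
    let inbox : (Fin n → Tape) → Fin n → Option (Message b) := fun ρ u =>
      if G.Adj u v then some (A.send (A.run G ρ t u) v) else none
    have hinbox : ∀ m, MeasurableSet {ρ | inbox ρ = m} := by
      intro m
      have : {ρ | inbox ρ = m} = ⋂ u, {ρ | inbox ρ u = m u} := by
        ext ρ
        simp [funext_iff]
      rw [this]
      refine MeasurableSet.iInter fun u => ?_
      by_cases hadj : G.Adj u v
      · simp only [inbox, hadj, if_true]
        cases m u with
        | none => simp
        | some w =>
          simp only [Option.some.injEq]
          exact ih u (A.measurable_send v w)
      · simp only [inbox, hadj, if_false]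
        exact MeasurableSet.const _
    intro s hs
    have : (fun ρ => A.run G ρ (t + 1) v) ⁻¹' s =
        ⋃ m, {ρ | inbox ρ = m} ∩ (fun ρ => A.step (A.run G ρ t v) m) ⁻¹' s := by
      ext ρ
      simp only [Set.mem_preimage, Set.mem_iUnion, Set.mem_inter_iff, Set.mem_ofPred_eq]
      constructor
      · intro h
        exact ⟨inbox ρ, rfl, by simpa [run, inbox] using h⟩
      · rintro ⟨m, rfl, h⟩
        simpa [run, inbox] using h
    rw [this]
    exact MeasurableSet.iUnion fun m =>
      (hinbox m).inter (((A.measurable_step m).comp (ih v)) hs)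

lemma measurableSet_outputSet (G : SimpleGraph (Fin n)) (t : ℕ) (p : Finset (Fin n) → Prop) :
    MeasurableSet {ρ | p (A.outputSet G ρ t)} := by
  classical
  have hv : ∀ v, MeasurableSet {ρ | A.output (A.run G ρ t v) = true} := fun v =>
    A.measurable_run G t v A.measurable_output
  have hS : ∀ S : Finset (Fin n), MeasurableSet {ρ | A.outputSet G ρ t = S} := by
    intro S
    have : {ρ | A.outputSet G ρ t = S} =
        ⋂ v, {ρ | A.output (A.run G ρ t v) = true ↔ v ∈ S} := by
      ext ρ
      simp [outputSet, Finset.ext_iff]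
    rw [this]
    exact MeasurableSet.iInter fun v => (hv v).iff (MeasurableSet.const _)
  have : {ρ | p (A.outputSet G ρ t)} = ⋃ S, {ρ | p S} ∩ {ρ | A.outputSet G ρ t = S} := by
    ext ρ
    simp only [Set.mem_iUnion, Set.mem_inter_iff, Set.mem_ofPred_eq]
    exact ⟨fun h => ⟨_, h, rfl⟩, fun ⟨S, h, h'⟩ => h' ▸ h⟩
  rw [this]
  exact MeasurableSet.iUnion fun S => (MeasurableSet.const _).inter (hS S)

/-- The cut-and-paste property of executions: let `G₃` look like `G₁` from the nodes on one side of
a cut and like `G₂` from the nodes on the other.  If the messages that cross the cut are the same in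
the executions on `G₁` and `G₂`, then on `G₃` each side behaves as in its own network. -/
lemma run_eq_of_cut (ρ : Fin n → Tape) (side : Fin n → Bool) {G₁ G₂ G₃ : SimpleGraph (Fin n)}
    (h₁ : ∀ u v, side v = false → (G₃.Adj u v ↔ G₁.Adj u v))
    (h₂ : ∀ u v, side v = true → (G₃.Adj u v ↔ G₂.Adj u v)) {T : ℕ}
    (hcut : ∀ t < T, ∀ u v, side u ≠ side v → G₃.Adj u v →
      A.send (A.run G₁ ρ t u) v = A.send (A.run G₂ ρ t u) v) :
    ∀ t ≤ T, ∀ v, A.run G₃ ρ t v = if side v then A.run G₂ ρ t v else A.run G₁ ρ t v := by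
  intro t
  induction t with
  | zero =>
    intro _ v
    have e : ∀ G : SimpleGraph (Fin n), (∀ u, G₃.Adj u v ↔ G.Adj u v) →
        G₃.neighborSet v = G.neighborSet v := by
      intro G h
      ext u
      simp only [SimpleGraph.mem_neighborSet, SimpleGraph.adj_comm _ v u, h]
    by_cases hv : side v = true
    · simp [run, hv, e G₂ fun u => h₂ u v hv]
    · simp [run, hv, e G₁ fun u => h₁ u v (by simpa using hv)]
  | succ t ih =>
    intro ht v
    have ih' := ih (by omega)
    by_cases hv : side v = true
    · simp only [run, hv, if_true, ih' v]
      congr 1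
      funext u
      by_cases hadj : G₃.Adj u v
      · have hadj' := (h₂ u v hv).1 hadj
        simp only [hadj, hadj', if_true, ih' u]
        by_cases hu : side u = true
        · simp [hu]
        · simp only [hu]
          simpa using hcut t (by omega) u v (by simp [hu, hv]) hadj
      · have hadj' : ¬ G₂.Adj u v := fun h => hadj ((h₂ u v hv).2 h)
        simp [hadj, hadj']
    · have hv' : side v = false := by simpa using hv
      simp only [run, hv', ih' v]
      simp only [Bool.false_eq_true, if_false]
      congr 1
      funext u
      by_cases hadj : G₃.Adj u v
      · have hadj' := (h₁ u v hv').1 hadj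
        simp only [hadj, hadj', if_true, ih' u]
        by_cases hu : side u = true
        · simp only [hu, if_true]
          simpa using (hcut t (by omega) u v (by simp [hu, hv']) hadj).symm
        · simp [hu]
      · have hadj' : ¬ G₁.Adj u v := fun h => hadj ((h₁ u v hv').2 h)
        simp [hadj, hadj']

end Congest.Algorithm

/-! ### The protocol of an approximation algorithm -/

namespace Congest

lemma card_message_le (b : ℕ) : Nat.card (Message b) ≤ 4 ^ b := by
  let f : Message b → Fin (b + 1) × (Fin b → Bool) := fun w =>
    (⟨w.1.length, Nat.lt_succ_of_le w.2⟩, fun i => w.1.getD i false)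
  have hf : Function.Injective f := by
    rintro ⟨w, hw⟩ ⟨w', hw'⟩ h
    simp only [f, Prod.mk.injEq, Fin.mk.injEq] at h
    refine Subtype.ext (List.ext_getElem h.1 fun i hi hi' => ?_)
    have := congrFun h.2 ⟨i, hi.trans_le hw⟩
    simpa [List.getD_eq_getElem?_getD, hi, hi'] using this
  refine (Nat.card_le_card_of_injective f hf).trans ?_
  rw [Nat.card_eq_fintype_card, Fintype.card_prod, Fintype.card_fun, Fintype.card_fin,
    Fintype.card_bool, Fintype.card_fin, show (4 : ℕ) = 2 * 2 from rfl, mul_pow]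
  exact Nat.mul_le_mul_right _ Nat.lt_two_pow_self

namespace Algorithm

variable {n b N L P : ℕ} (A : Algorithm n b) (σ : Fin n ≃ Node N L P) (T : ℕ)
  (ρ : Fin n → Tape)

/-- The execution on the lower bound network, placed on `Fin n` by `σ`. -/
noncomputable def runOn (x y : Finset (Fin N)) (t : ℕ) (v : Node N L P) : A.State :=
  A.run ((Node.network L P x y).comap σ) ρ t (σ.symm v)

/-- The messages sent between the two sides of the lower bound network in the first `T`
rounds. -/
noncomputable def cutMessages (x y : Finset (Fin N)) :
    Fin T × Bool × Fin L × Bool → Message b :=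
  fun q => A.send (A.runOn σ ρ x y q.1 (.bit q.2.1 q.2.2.1 q.2.2.2))
    (σ.symm (.bit (!q.2.1) q.2.2.1 q.2.2.2))

open Classical in
/-- The candidate that declares itself a center, if there is exactly one. -/
noncomputable def chosen (x y : Finset (Fin N)) : Option (Fin N) :=
  if h : ∃ i : Fin N, ∀ j, A.output (A.runOn σ ρ x y T (.candidate j)) = true ↔ j = i then
    some h.choose else none

/-- The data that the two parties exchange: the messages across the cut, followed by the chosen
candidate and by whether it belongs to the set of either party. -/
noncomputable def transcript (x y : Finset (Fin N)) :
    (Fin T × Bool × Fin L × Bool → Message b) × Option (Fin N) × Bool × Bool :=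
  (A.cutMessages σ T ρ x y, A.chosen σ T ρ x y,
    (A.chosen σ T ρ x y).any (· ∈ x), (A.chosen σ T ρ x y).any (· ∈ y))

variable {σ T ρ}

lemma runOn_eq_of_cutMessages_eq {x y x' y' : Finset (Fin N)}
    (h : A.cutMessages σ T ρ x y = A.cutMessages σ T ρ x' y') {t : ℕ} (ht : t ≤ T)
    (v : Node N L P) :
    A.runOn σ ρ x y' t v =
      if Node.onCheckerSide v then A.runOn σ ρ x' y' t v else A.runOn σ ρ x y t v := by
  have := A.run_eq_of_cut ρ (fun v => Node.onCheckerSide (σ v))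
    (G₁ := (Node.network L P x y).comap σ) (G₂ := (Node.network L P x' y').comap σ)
    (G₃ := (Node.network L P x y').comap σ)
    (fun u v hv => Node.adj_iff_of_onCheckerSide_eq_false hv)
    (fun u v hv => Node.adj_iff_of_onCheckerSide_eq_true hv) (T := T) (by
      intro t ht u v hs hadj
      obtain ⟨s, k, e, hu, hv⟩ := Node.exists_bit_of_adj (SimpleGraph.comap_adj.1 hadj) hs
      have := congrFun h (⟨t, ht⟩, s, k, e)
      simp only [cutMessages, runOn, ← hu, ← hv, Equiv.symm_apply_apply] at this
      exact this) t ht (σ.symm v)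
  simpa only [runOn, Equiv.apply_symm_apply] using this

lemma transcript_rectangle {x y x' y' : Finset (Fin N)}
    (h : A.transcript σ T ρ x y = A.transcript σ T ρ x' y') :
    A.transcript σ T ρ x y' = A.transcript σ T ρ x y := by
  simp only [transcript, Prod.mk.injEq] at h
  obtain ⟨hcut, hch, hx, hy⟩ := h
  have hcut' : A.cutMessages σ T ρ x y' = A.cutMessages σ T ρ x y := by
    funext q
    have hq := congrFun hcut q
    simp only [cutMessages] at hq ⊢
    rw [A.runOn_eq_of_cutMessages_eq hcut q.1.2.le]
    split_ifs
    · exact hq.symm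
    · rfl
  have hch' : A.chosen σ T ρ x y' = A.chosen σ T ρ x y := by
    have : ∀ j, A.runOn σ ρ x y' T (.candidate j) = A.runOn σ ρ x y T (.candidate j) := by
      intro j
      rw [A.runOn_eq_of_cutMessages_eq hcut le_rfl]
      simp [Node.onCheckerSide]
    simp only [chosen, this]
  simp only [transcript, hcut', hch', Prod.mk.injEq, true_and]
  rw [hy, hch]

lemma not_disjoint_of_transcript {x y : Finset (Fin N)}
    (hx : (A.transcript σ T ρ x y).2.2.1 = true) (hy : (A.transcript σ T ρ x y).2.2.2 = true) :
    ¬ Disjoint x y := by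
  simp only [transcript, Option.any_eq_true, decide_eq_true_eq] at hx hy
  obtain ⟨i, hi, hix⟩ := hx
  obtain ⟨j, hj, hjy⟩ := hy
  rw [hi, Option.some.injEq] at hj
  subst hj
  exact Finset.not_disjoint_iff.2 ⟨i, hix, hjy⟩

lemma transcript_of_isApprox {x y : Finset (Fin N)} {i : Fin N} (hx : i ∈ x) (hy : i ∈ y)
    (hL : 0 < L) (hN : N ≤ 2 ^ L) {α : ℝ} (hα : α < 4 / 3)
    (h : KCenter.IsApprox ((Node.network L P x y).comap σ) 1 α
      (A.outputSet ((Node.network L P x y).comap σ) ρ T)) :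
    (A.transcript σ T ρ x y).2.2.1 = true ∧ (A.transcript σ T ρ x y).2.2.2 = true := by
  obtain ⟨j, hjx, hjy, hj⟩ := Node.eq_singleton_of_isApprox σ hx hy hL hN hα h
  have hout : ∀ k, A.output (A.runOn σ ρ x y T (.candidate k)) = true ↔ k = j := by
    intro k
    have : σ.symm (.candidate k) ∈ A.outputSet ((Node.network L P x y).comap σ) ρ T ↔
        A.output (A.runOn σ ρ x y T (.candidate k)) = true := by
      simp [outputSet, runOn]
    rw [← this, hj, Finset.mem_singleton, σ.symm.injective.eq_iff, Node.candidate.injEq]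
  have hch : A.chosen σ T ρ x y = some j := by
    have hex : ∃ i : Fin N, ∀ k,
        A.output (A.runOn σ ρ x y T (.candidate k)) = true ↔ k = i := ⟨j, hout⟩
    rw [chosen, dif_pos hex, Option.some.injEq]
    exact ((hex.choose_spec j).1 ((hout j).2 rfl)).symm
  simp [transcript, hch, hjx, hjy]

instance : IsProbabilityMeasure tapeLaw := by
  unfold tapeLaw
  infer_instance

instance (n : ℕ) : IsProbabilityMeasure (tapesLaw n) := by
  unfold tapesLaw
  infer_instance

/-- The communication bound: five executions with suitable fixed tapes form a protocol for
disjointness, so their transcripts are exponentially many. -/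
theorem transcripts_lower_bound (A : Algorithm n b) (σ : Fin n ≃ Node N L P) (hN0 : 0 < N)
    (hL : 0 < L) (hN : N ≤ 2 ^ L) {α : ℝ} (hα : α < 4 / 3) {T : ℕ}
    (hA : A.ApproximatesKCenter 1 α T) :
    (1 / 128 : ℝ) ≤ ((4 ^ b) ^ (T * (4 * L)) * (4 * (N + 1))) ^ 5 * (9 / 10) ^ (N / 36) := by
  classical
  have := message_finite b
  let _ := Fintype.ofFinite (Message b)
  have : Nonempty (Fin N) := ⟨⟨0, hN0⟩⟩
  let X : Fin N × Finset (Fin N) × Finset (Fin N) → Finset (Fin N) :=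
    fun p => insert p.1 (p.2.2 ∩ p.2.1)
  let Y : Fin N × Finset (Fin N) × Finset (Fin N) → Finset (Fin N) :=
    fun p => insert p.1 (p.2.2 \ p.2.1)
  have hX : ∀ p, p.1 ∈ X p := fun p => Finset.mem_insert_self _ _
  have hY : ∀ p, p.1 ∈ Y p := fun p => Finset.mem_insert_self _ _
  obtain ⟨ρ, hρ⟩ := exists_sample_points (tapesLaw n) Finset.univ
    (fun p => {ρ | KCenter.IsApprox ((Node.network L P (X p) (Y p)).comap σ) 1 α
      (A.outputSet ((Node.network L P (X p) (Y p)).comap σ) ρ T)})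
    (fun p _ => A.measurableSet_outputSet _ T _)
    (fun p _ => hA _ (Node.network_comap_connected σ (hX p) (hY p) hL hN)) 5
  have key := card_transcripts_ge (fun x y (j : Fin 5) => A.transcript σ T (ρ j) x y)
    (fun x y x' y' h => funext fun j => A.transcript_rectangle (congrFun h j))
    (fun r => ∃ j, (r j).2.2.1 = true ∧ (r j).2.2.2 = true)
    (fun x y hd ⟨j, h1, h2⟩ => A.not_disjoint_of_transcript h1 h2 hd) (by
      have hcard : (Finset.univ : Finset (Fin N × Finset (Fin N) × Finset (Fin N))).card =
          Fintype.card (Fin N) * 4 ^ Fintype.card (Fin N) := by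
        rw [Finset.card_univ, Fintype.card_prod, Fintype.card_prod, Fintype.card_finset, ← mul_pow]
        norm_num
      rw [hcard] at hρ
      refine le_trans (Nat.mul_le_mul_left _ (Finset.card_le_card ?_)) hρ
      intro p hp
      simp only [Finset.mem_filter, Finset.mem_univ, true_and] at hp ⊢
      intro j hj
      exact hp ⟨j, A.transcript_of_isApprox (hX p) (hY p) hL hN hα hj⟩)
  refine key.trans ?_
  rw [Fintype.card_fin]
  refine mul_le_mul_of_nonneg_right ?_ (by positivity)
  have hM : Fintype.card (Message b) ≤ 4 ^ b := by
    rw [← Nat.card_eq_fintype_card]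
    exact card_message_le b
  have : Fintype.card (Fin 5 → (Fin T × Bool × Fin L × Bool → Message b) ×
      Option (Fin N) × Bool × Bool) ≤ ((4 ^ b) ^ (T * (4 * L)) * (4 * (N + 1))) ^ 5 := by
    rw [Fintype.card_fun, Fintype.card_fin]
    refine Nat.pow_le_pow_left ?_ 5
    rw [Fintype.card_prod, Fintype.card_fun]
    refine Nat.mul_le_mul ?_ ?_
    · refine (Nat.pow_le_pow_left hM _).trans_eq ?_
      congr 1
      simp only [Fintype.card_prod, Fintype.card_fin, Fintype.card_bool]
      ring
    · simp only [Fintype.card_prod, Fintype.card_option, Fintype.card_fin, Fintype.card_bool]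
      omega
  exact_mod_cast this

end Algorithm

end Congest

/-! ### The bound on the number of rounds -/

/-- The thresholds on `n` that make the lower order terms of the final estimate negligible. -/
lemma exists_nat_log_le : ∃ n₀ : ℕ, 8 ≤ n₀ ∧ ∀ n : ℕ, n₀ ≤ n →
    1 ≤ Real.log n ∧ 16 * Real.log n ≤ n / 5760 := by
  have h1 : ∀ᶠ n : ℕ in Filter.atTop, (1 : ℝ) ≤ Real.log n :=
    (Real.tendsto_log_atTop.comp tendsto_natCast_atTop_atTop).eventually_ge_atTop 1
  have h2 : ∀ᶠ n : ℕ in Filter.atTop, ‖Real.log n‖ ≤ 1 / 92160 * ‖(id (n : ℝ))‖ :=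
    tendsto_natCast_atTop_atTop.eventually
      (Real.isLittleO_log_id_atTop.bound (by norm_num : (0 : ℝ) < 1 / 92160))
  obtain ⟨m, hm⟩ := Filter.eventually_atTop.1 (h1.and h2)
  refine ⟨max m 8, le_max_right _ _, fun n hn => ?_⟩
  obtain ⟨a, b⟩ := hm n ((le_max_left _ _).trans hn)
  refine ⟨a, ?_⟩
  rw [Real.norm_of_nonneg (by linarith), id, Real.norm_of_nonneg (Nat.cast_nonneg n)] at b
  linarith

lemma natLog_two_add_one_le {n : ℕ} (hn : n ≠ 0) (h : 1 ≤ Real.log n) :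
    ((Nat.log 2 n + 1 : ℕ) : ℝ) ≤ 3 * Real.log n := by
  have h1 : ((2 ^ Nat.log 2 n : ℕ) : ℝ) ≤ n := by exact_mod_cast Nat.pow_log_le_self 2 hn
  have h2 := Real.log_le_log (by positivity) h1
  push_cast at h2 ⊢
  rw [Real.log_pow] at h2
  have := Real.log_two_gt_d9
  have h3 : (0 : ℝ) ≤ Nat.log 2 n := Nat.cast_nonneg _
  nlinarith

theorem mainTheorem2 (β : ℝ) (hβ : 0 < β) :
    ∃ c : ℝ, 0 < c ∧ ∃ n₀ : ℕ, ∀ n b : ℕ, n₀ ≤ n → (b : ℝ) ≤ β * Real.log n →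
      ∀ (A : Congest.Algorithm n b) (α : ℝ) (T : ℕ), 1 ≤ α → α < 4 / 3 →
        A.ApproximatesKCenter 1 α T →
          c * ((n : ℝ) / Real.log n ^ 2) ≤ (T : ℝ) := by
  obtain ⟨n₀, hn₀, hlog⟩ := exists_nat_log_le
  refine ⟨1 / (691200 * β), by positivity, n₀, fun n b hn hb A α T _ hα hA => ?_⟩
  obtain ⟨h1, h16⟩ := hlog n hn
  set L := Nat.log 2 n + 1 with hL
  set N := n / 4 with hN
  have hn8 : 8 ≤ n := hn₀.trans hn
  have hLlog : (L : ℝ) ≤ 3 * Real.log n := natLog_two_add_one_le (by omega) h1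
  have hNL : N ≤ 2 ^ L :=
    (Nat.div_le_self n 4).trans (Nat.lt_pow_succ_log_self (by norm_num) n).le
  have hsize : N + N + 4 * L + 4 ≤ n := by
    have : ((4 * L + 4 : ℕ) : ℝ) ≤ (n : ℝ) / 2 := by
      push_cast
      have : (0 : ℝ) ≤ n := Nat.cast_nonneg n
      linarith
    have : 2 * (4 * L + 4) ≤ n := by
      have h : (2 : ℝ) * ((4 * L + 4 : ℕ) : ℝ) ≤ n := by linarith
      exact_mod_cast h
    omega
  obtain ⟨σ⟩ := Node.exists_equiv_fin (N := N) (L := L) (P := n - (N + N + 4 * L + 4)) (n := n)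
    (by omega)
  have key := A.transcripts_lower_bound σ (by omega) (by omega) hNL hα hA
  have key' := Real.log_le_log (by norm_num) key
  rw [Real.log_mul (by positivity) (by positivity), Real.log_pow, Real.log_pow,
    Real.log_mul (by positivity) (by positivity), Real.log_pow, Real.log_pow] at key'
  have l128 : -5 ≤ Real.log (1 / 128) := by
    rw [show (1 / 128 : ℝ) = (2 ^ 7)⁻¹ by norm_num, Real.log_inv, Real.log_pow]
    have := Real.log_two_lt_d9
    norm_num
    linarith
  have l4 : Real.log 4 ≤ 2 := by
    rw [show (4 : ℝ) = 2 ^ 2 by norm_num, Real.log_pow]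
    have := Real.log_two_lt_d9
    norm_num
    linarith
  have l9 : Real.log (9 / 10) ≤ -(1 / 10) := by
    have := Real.log_le_sub_one_of_pos (show (0 : ℝ) < 9 / 10 by norm_num)
    linarith
  have hN4 : Real.log (4 * (N + 1)) ≤ 2 * Real.log n := by
    have h : 4 * (N + 1) ≤ n ^ 2 := by
      have : 4 * N ≤ n := Nat.mul_div_le n 4
      nlinarith
    have h' : (4 * ((N : ℝ) + 1)) ≤ (n : ℝ) ^ 2 := by exact_mod_cast h
    have := Real.log_le_log (by positivity) h'
    rwa [Real.log_pow] at this
  have hN36 : (n : ℝ) / 288 - 1 ≤ ((N / 36 : ℕ) : ℝ) := by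
    have : n ≤ 288 * (N / 36 + 1) := by omega
    have : (n : ℝ) ≤ 288 * (((N / 36 : ℕ) : ℝ) + 1) := by exact_mod_cast this
    linarith
  have hbLT : (b : ℝ) * L * T ≤ 3 * β * Real.log n ^ 2 * T := by
    refine mul_le_mul_of_nonneg_right ?_ (Nat.cast_nonneg T)
    calc (b : ℝ) * L ≤ (β * Real.log n) * (3 * Real.log n) :=
          mul_le_mul hb hLlog (Nat.cast_nonneg L) (by positivity)
      _ = 3 * β * Real.log n ^ 2 := by ring
  have hbits : (b : ℝ) * L * T * Real.log 4 ≤ b * L * T * 2 :=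
    mul_le_mul_of_nonneg_left l4 (by positivity)
  have hdecay : ((N / 36 : ℕ) : ℝ) * Real.log (9 / 10) ≤ ((N / 36 : ℕ) : ℝ) * -(1 / 10) :=
    mul_le_mul_of_nonneg_left l9 (Nat.cast_nonneg _)
  push_cast at key'
  have hfinal : (n : ℝ) ≤ 691200 * β * Real.log n ^ 2 * T := by
    have e : (5 : ℝ) * (T * (4 * L) * (b * Real.log 4) + Real.log (4 * (N + 1))) =
        20 * (b * L * T * Real.log 4) + 5 * Real.log (4 * (N + 1)) := by ring
    rw [e] at key'
    linarith
  rw [div_mul_div_comm, one_mul, div_le_iff₀ (by positivity)]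
  linarith
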